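/- Let $\theta\in\{\pi/4,\,3\pi/4\}$ and let $\alpha,\beta\in\mathbb{C}$ satisfy $|\alpha|^2+|\beta|^2=1$. On the Hilbert space $\ell^2(\mathbb{Z})\otimes\mathbb{C}^2$, with orthonormal bases $\{|x\rangle : x\in\mathbb{Z}\}$ of $\ell^2(\mathbb{Z})$ and $\{|0\rangle,|1\rangle\}$ of $\mathbb{C}^2$, let $$\begin{aligned} U_1=\sum_{x\in\mathbb{Z}}\Bigl[&|x-1\rangle\langle x|\otimes\tfrac{\cos\theta}{2}\bigl(|0\rangle\langle 0|-|1\rangle\langle 0|+|0\rangle\langle 1|-|1\rangle\langle 1|\bigr)+|x\rangle\langle x|\otimes\sin\theta\,\bigl(|0\rangle\langle 1|+|1\rangle\langle 0|\bigr)\\ &+|x+1\rangle\langle x|\otimes\tfrac{\cos\theta}{2}\bigl(|0\rangle\langle 0|+|1\rangle\langle 0|-|0\rangle\langle 1|-|1\rangle\langle 1|\bigr)\Bigr],\\ U_2=\sum_{x\in\mathbb{Z}}\Bigl[&|x-1\rangle\langle x|\otimes\sin\theta\,|0\rangle\langle 1|+|x\rangle\langle x|\otimes\cos\theta\,\bigl(|0\rangle\langle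 0|-|1\rangle\langle 1|\bigr)+|x+1\rangle\langle x|\otimes\sin\theta\,|1\rangle\langle 0|\Bigr]. \end{aligned}$$ Let $\Psi_0=|0\rangle\otimes(\alpha|0\rangle+\beta|1\rangle)$ and $\Psi_{t+1}=U_2U_1\Psi_t$ for $t=0,1,2,\dots$, and let $X_t$ be the position of the quantum walker at time $t$, that is, the $\mathbb{Z}$-valued random variable with $$\mathbb{P}(X_t=x)=\langle\Psi_t|\,\bigl\{|x\rangle\langle x|\otimes(|0\rangle\langle 0|+|1\rangle\langle 1|)\bigr\}\,|\Psi_t\rangle\qquad(x\in\mathbb{Z});$$ these numbers do form a probability distribution on $\mathbb{Z}$. Put $$\chi(y)=\frac{2\sqrt2}{\pi(4-y^2)\sqrt{2-y^2}}\Bigl\{1-\bigl(|\alpha|^2-|\beta|^2+\alpha\overline{\beta}+\overline{\alpha}\beta\bigr)\frac{y}{2}\Bigr\}\quad\text{for } y\in(-\sqrt2,\sqrt2),\qquad \chi(y)=0\quad\text{otherwise.}$$ Then $\chi$ is a probability density on $\mathbb{R}$ that is strictly positive on the whole interval $(-\sqrt2,\sqrt2)$ (so the limit distribution has no gap), and $X_t/t$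 converges in distribution to the law with density $\chi$: for every real number $x$, $$\lim_{t\to\infty}\mathbb{P}\Bigl(\frac{X_t}{t}\le x\Bigr)=\int_{-\infty}^{x}\chi(y)\,dy .$$ -/

import Mathlib

open MeasureTheory Filter Topology
open scoped ComplexConjugate

noncomputable section

namespace QWalk

/-- The coin space `ℂ²` with orthonormal basis `|0⟩, |1⟩`. -/
abbrev Coin : Type := EuclideanSpace ℂ (Fin 2)

/-- The Hilbert space `ℓ²(ℤ) ⊗ ℂ²` of the walk, realised as the space `ℓ²(ℤ; ℂ²)`;
`Ψ x` is the coin component of `Ψ` at the position `x`, and `|x⟩ ⊗ v` is `lp.single 2 x v`. -/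
abbrev Space : Type := lp (fun _ : ℤ => Coin) 2

theorem memℓp_hop (d : ℤ) (A : Matrix (Fin 2) (Fin 2) ℂ) (Ψ : Space) :
    Memℓp (fun x : ℤ => (Matrix.toEuclideanCLM (n := Fin 2) (𝕜 := ℂ) A (Ψ (x - d)) : Coin)) 2 := by
  have h : Summable fun x : ℤ => ‖Ψ x‖ ^ (2 : ENNReal).toReal :=
    (lp.memℓp Ψ).summable (by norm_num)
  have h2 : Summable fun x : ℤ => ‖Ψ (x - d)‖ ^ (2 : ENNReal).toReal :=
    h.comp_injective (sub_left_injective (b := d))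
  refine memℓp_gen (Summable.of_nonneg_of_le (fun x => by positivity) (fun x => ?_)
    (h2.mul_left (‖Matrix.toEuclideanCLM (n := Fin 2) (𝕜 := ℂ) A‖ ^ (2 : ENNReal).toReal)))
  rw [← Real.mul_rpow (norm_nonneg _) (norm_nonneg _)]
  exact Real.rpow_le_rpow (norm_nonneg _) (ContinuousLinearMap.le_opNorm _ _) (by norm_num)

/-- The operator `∑ₓ |x + d⟩⟨x| ⊗ A`. -/
def hop (d : ℤ) (A : Matrix (Fin 2) (Fin 2) ℂ) : Space →ₗ[ℂ] Space where
  toFun Ψ := ⟨fun x => Matrix.toEuclideanCLM (n := Fin 2) (𝕜 := ℂ) A (Ψ (x - d)), memℓp_hop d A Ψ⟩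
  map_add' Ψ Φ := by
    ext1; funext x
    exact map_add (Matrix.toEuclideanCLM (n := Fin 2) (𝕜 := ℂ) A) (Ψ (x - d)) (Φ (x - d))
  map_smul' z Ψ := by
    ext1; funext x
    exact map_smul (Matrix.toEuclideanCLM (n := Fin 2) (𝕜 := ℂ) A) z (Ψ (x - d))

/-- The matrix `|i⟩⟨j|` on the coin space. -/
def ketbra (i j : Fin 2) : Matrix (Fin 2) (Fin 2) ℂ := Matrix.single i j 1

/-- The first unitary operation. -/
def U₁ (θ : ℝ) : Space →ₗ[ℂ] Space :=
  hop (-1) (((Real.cos θ / 2 : ℝ) : ℂ) • (ketbra 0 0 - ketbra 1 0 + ketbra 0 1 - ketbra 1 1))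
    + hop 0 ((Real.sin θ : ℂ) • (ketbra 0 1 + ketbra 1 0))
    + hop 1 (((Real.cos θ / 2 : ℝ) : ℂ) • (ketbra 0 0 + ketbra 1 0 - ketbra 0 1 - ketbra 1 1))

/-- The second unitary operation. -/
def U₂ (θ : ℝ) : Space →ₗ[ℂ] Space :=
  hop (-1) ((Real.sin θ : ℂ) • ketbra 0 1)
    + hop 0 ((Real.cos θ : ℂ) • (ketbra 0 0 - ketbra 1 1))
    + hop 1 ((Real.sin θ : ℂ) • ketbra 1 0)

/-- The state `Ψ_t`: it starts at `|0⟩ ⊗ (α|0⟩ + β|1⟩)` and satisfies `Ψ_{t+1} = U₂ U₁ Ψ_t`. -/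
def state (θ : ℝ) (α β : ℂ) : ℕ → Space
  | 0 => lp.single 2 (0 : ℤ) !₂[α, β]
  | t + 1 => U₂ θ (U₁ θ (state θ α β t))

/-- The projection `|x⟩⟨x| ⊗ (|0⟩⟨0| + |1⟩⟨1|)`, applied to `Ψ`. -/
def positionProj (x : ℤ) (Ψ : Space) : Space := lp.single 2 x (Ψ x)

/-- The finding probability `ℙ(X_t = x) = ⟨Ψ_t| {|x⟩⟨x| ⊗ (|0⟩⟨0| + |1⟩⟨1|)} |Ψ_t⟩`. -/
def findingProb (θ : ℝ) (α β : ℂ) (t : ℕ) (x : ℤ) : ℝ :=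
  (inner ℂ (state θ α β t) (positionProj x (state θ α β t))).re

/-- The law of the position `X_t` on `ℤ`. -/
def law (θ : ℝ) (α β : ℂ) (t : ℕ) : Measure ℤ :=
  Measure.sum fun x : ℤ => ENNReal.ofReal (findingProb θ α β t x) • Measure.dirac x

/-- The limit density (the number `α β̄ + ᾱ β` is real). -/
def limitDensity (α β : ℂ) : ℝ → ℝ :=
  (Set.Ioo (-√2) √2).indicator fun y =>
    2 * √2 / (Real.pi * (4 - y ^ 2) * √(2 - y ^ 2)) *
      (1 - (‖α‖ ^ 2 - ‖β‖ ^ 2 + (α * conj β + conj α * β).re) * (y / 2))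

end QWalk

end

/-!
In the momentum representation one step of the walk is multiplication by a unitary `2 × 2` matrix,
its symbol, so by Parseval's identity the characteristic function of `X_t` at `η` is the mean over
`k` of `⟨φ, (M(k)ᵗ)* M(k - η)ᵗ φ⟩`, with `M` the symbol and `φ = α|0⟩ + β|1⟩`. At `θ = π / 4` the
symbol is `exp (i ω(k) N(k))` with `ω(k) = 2 arcsin (sin² (k / 2))` and `N(k)` a Hermitian
involution depending continuously on `k`. For `η = ξ / t` the integrand therefore tends to `⟨φ, exp
(-i ξ ω'(k) N(k)) φ⟩` for `|k| < π`, and the limit passes through the integral by dominated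
convergence.

The group velocity `ω'` maps `(-π, π)` bijectively onto `(-√2, √2)`; the terms odd in `k` integrate
to `0`, and the substitution `y = ω'(k)` turns the remaining ones into the characteristic function
of the limit density. Lévy's continuity theorem concludes.

The case `θ = 3π / 4` has the same position law: up to a global sign at each step, replacing `θ` by
`π - θ` amounts to conjugating the walk by the multiplication operator `(-1)ˣ`.
-/

noncomputable section

namespace QWalk

/-! ### Trigonometric sums -/

section FourierSum

variable {E F : Type*} [AddCommGroup E] [Module ℂ E] [AddCommGroup F] [Module ℂ F]

/-- The momentum representation `k ↦ ∑ₓ e^{-ikx} v(x)` of a vector-valued function on `ℤ`. It is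
defined by a finite sum, so it has the junk value `0` unless `v` has finite support. -/
def fourierSum (v : ℤ → E) (k : ℝ) : E :=
  ∑ᶠ x : ℤ, Complex.exp (-(k * x * Complex.I)) • v x

theorem fourierSum_add {v w : ℤ → E} (hv : v.HasFiniteSupport) (hw : w.HasFiniteSupport) (k : ℝ) :
    fourierSum (v + w) k = fourierSum v k + fourierSum w k := by
  simp only [fourierSum, Pi.add_apply, smul_add]
  exact finsum_add_distrib (hv.smul_right _) (hw.smul_right _)

theorem fourierSum_map (f : E →ₗ[ℂ] F) {v : ℤ → E} (hv : v.HasFiniteSupport) (k : ℝ) :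
    fourierSum (fun x => f (v x)) k = f (fourierSum v k) := by
  simp only [fourierSum, ← map_smul]
  exact (f.toAddMonoidHom.map_finsum (hv.smul_right _)).symm

theorem fourierSum_translate (d : ℤ) (v : ℤ → E) (k : ℝ) :
    fourierSum (fun x => v (x - d)) k =
      Complex.exp (-(k * d * Complex.I)) • fourierSum v k := by
  rw [fourierSum, fourierSum, smul_finsum, ← finsum_comp_equiv (Equiv.addRight d)]
  refine finsum_congr fun x => ?_
  rw [Equiv.coe_addRight, add_sub_cancel_right, smul_smul, ← Complex.exp_add]
  congr 2
  push_cast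
  ring

theorem fourierSum_sub (v : ℤ → E) (k η : ℝ) :
    fourierSum v (k - η) = fourierSum (fun x => Complex.exp (η * x * Complex.I) • v x) k := by
  refine finsum_congr fun x => ?_
  rw [smul_smul, ← Complex.exp_add]
  congr 2
  push_cast
  ring

theorem fourierSum_single_zero (e : E) (k : ℝ) : fourierSum (Pi.single 0 e) k = e := by
  rw [fourierSum, finsum_eq_single _ 0 fun x hx => by rw [Pi.single_eq_of_ne hx, smul_zero]]
  simp

theorem fourierSum_eq_sum {v : ℤ → E} {s : Finset ℤ} (hs : v.support ⊆ s) (k : ℝ) :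
    fourierSum v k = ∑ x ∈ s, Complex.exp (-(k * x * Complex.I)) • v x :=
  finsum_eq_sum_of_support_subset _ ((Function.support_smul_subset_right _ v).trans hs)

end FourierSum

theorem integral_exp_int_mul_I (n : ℤ) :
    ∫ k in (-Real.pi)..Real.pi, Complex.exp (k * n * Complex.I) =
      if n = 0 then (2 * Real.pi : ℂ) else 0 := by
  split_ifs with h
  · subst h
    simp only [Int.cast_zero, mul_zero, zero_mul, Complex.exp_zero, intervalIntegral.integral_const,
      sub_neg_eq_add, Complex.real_smul, Complex.ofReal_add, mul_one]
    ring
  · have hn : (n * Complex.I : ℂ) ≠ 0 := mul_ne_zero (by exact_mod_cast h) Complex.I_ne_zero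
    have primitive := integral_exp_mul_complex (a := -Real.pi) (b := Real.pi) hn
    simp only [mul_comm (n * Complex.I : ℂ), ← mul_assoc] at primitive
    rw [primitive, div_eq_zero_iff, sub_eq_zero, Complex.exp_eq_exp_iff_exists_int]
    refine Or.inl ⟨n, ?_⟩
    push_cast
    ring

theorem integral_inner_fourierSum {E : Type*} [NormedAddCommGroup E] [InnerProductSpace ℂ E]
    {u w : ℤ → E} (hu : u.HasFiniteSupport) (hw : w.HasFiniteSupport) :
    ∫ k in (-Real.pi)..Real.pi, inner ℂ (fourierSum u k) (fourierSum w k) =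
      2 * Real.pi * ∑ᶠ x, inner ℂ (u x) (w x) := by
  obtain ⟨s, hs⟩ := (hu.union hw).exists_finset_coe
  have hus : u.support ⊆ s := hs ▸ Set.subset_union_left
  have hws : w.support ⊆ s := hs ▸ Set.subset_union_right
  have expand (k : ℝ) : inner ℂ (fourierSum u k) (fourierSum w k) =
      ∑ x ∈ s, ∑ y ∈ s, Complex.exp (k * (x - y : ℤ) * Complex.I) * inner ℂ (u x) (w y) := by
    rw [fourierSum_eq_sum hus, fourierSum_eq_sum hws, sum_inner]
    refine Finset.sum_congr rfl fun x _ => ?_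
    rw [inner_sum]
    refine Finset.sum_congr rfl fun y _ => ?_
    rw [inner_smul_left, inner_smul_right, ← mul_assoc, ← Complex.exp_conj, ← Complex.exp_add]
    congr 2
    simp only [map_neg, map_mul, Complex.conj_ofReal, Complex.conj_I, map_intCast, Int.cast_sub]
    ring
  have diagonal : ∑ᶠ x, inner ℂ (u x) (w x) = ∑ x ∈ s, inner ℂ (u x) (w x) :=
    finsum_eq_sum_of_support_subset _ fun x hx => hus fun h => hx (by simp [h])
  simp_rw [expand, diagonal, Finset.mul_sum]
  rw [intervalIntegral.integral_finsetSum
    fun x _ => Continuous.intervalIntegrable (by fun_prop) _ _]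
  refine Finset.sum_congr rfl fun x hx => ?_
  rw [intervalIntegral.integral_finsetSum
    fun y _ => Continuous.intervalIntegrable (by fun_prop) _ _]
  simp_rw [intervalIntegral.integral_mul_const, integral_exp_int_mul_I, sub_eq_zero, ite_mul,
    zero_mul, Finset.sum_ite_eq, if_pos hx]

/-! ### The walk in momentum space -/

/-- `T` acts on finitely supported vectors as multiplication by the matrix `M k` in the momentum
representation. -/
structure HasSymbol (T : Space →ₗ[ℂ] Space) (M : ℝ → Matrix (Fin 2) (Fin 2) ℂ) : Prop where
  hasFiniteSupport {Ψ : Space} :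
    Function.HasFiniteSupport (Ψ : ℤ → Coin) → Function.HasFiniteSupport (T Ψ : ℤ → Coin)
  fourierSum_apply {Ψ : Space} (hΨ : Function.HasFiniteSupport (Ψ : ℤ → Coin)) (k : ℝ) :
    fourierSum (T Ψ) k = Matrix.toEuclideanCLM (𝕜 := ℂ) (M k) (fourierSum Ψ k)

theorem HasSymbol.add {S T : Space →ₗ[ℂ] Space} {M N : ℝ → Matrix (Fin 2) (Fin 2) ℂ}
    (hS : HasSymbol S M) (hT : HasSymbol T N) : HasSymbol (S + T) (fun k => M k + N k) where
  hasFiniteSupport hΨ := (hS.hasFiniteSupport hΨ).add (hT.hasFiniteSupport hΨ)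
  fourierSum_apply hΨ k := by
    rw [LinearMap.add_apply, lp.coeFn_add,
      fourierSum_add (hS.hasFiniteSupport hΨ) (hT.hasFiniteSupport hΨ), hS.fourierSum_apply hΨ,
      hT.fourierSum_apply hΨ, map_add, add_apply]

theorem HasSymbol.comp {S T : Space →ₗ[ℂ] Space} {M N : ℝ → Matrix (Fin 2) (Fin 2) ℂ}
    (hS : HasSymbol S M) (hT : HasSymbol T N) : HasSymbol (S ∘ₗ T) (fun k => M k * N k) where
  hasFiniteSupport hΨ := hS.hasFiniteSupport (hT.hasFiniteSupport hΨ)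
  fourierSum_apply hΨ k := by
    rw [LinearMap.comp_apply, hS.fourierSum_apply (hT.hasFiniteSupport hΨ),
      hT.fourierSum_apply hΨ, map_mul, mul_apply_eq_comp]

theorem hasSymbol_hop (d : ℤ) (A : Matrix (Fin 2) (Fin 2) ℂ) :
    HasSymbol (hop d A) (fun k => Complex.exp (-(k * d * Complex.I)) • A) where
  hasFiniteSupport hΨ := (hΨ.comp_of_injective (sub_left_injective (b := d))).fun_comp
    (g := Matrix.toEuclideanCLM (𝕜 := ℂ) A) (map_zero _)
  fourierSum_apply {Ψ} hΨ k :=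
    calc fourierSum (fun x => Matrix.toEuclideanCLM (𝕜 := ℂ) A (Ψ (x - d))) k
      _ = Matrix.toEuclideanCLM (𝕜 := ℂ) A (fourierSum (fun x => Ψ (x - d)) k) :=
        fourierSum_map (Matrix.toEuclideanCLM (𝕜 := ℂ) A).toLinearMap
          (hΨ.comp_of_injective sub_left_injective) k
      _ = _ := by rw [fourierSum_translate, map_smul, map_smul, smul_apply]

/-- The symbol of `U₁`. -/
def symbol₁ (θ k : ℝ) : Matrix (Fin 2) (Fin 2) ℂ :=
  !![(Real.cos θ : ℂ) * Real.cos k, Real.sin θ + Real.cos θ * Real.sin k * Complex.I;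
    Real.sin θ - Real.cos θ * Real.sin k * Complex.I, -(Real.cos θ * Real.cos k)]

/-- The symbol of `U₂`. -/
def symbol₂ (θ k : ℝ) : Matrix (Fin 2) (Fin 2) ℂ :=
  !![(Real.cos θ : ℂ), Real.sin θ * (Real.cos k + Real.sin k * Complex.I);
    Real.sin θ * (Real.cos k - Real.sin k * Complex.I), -Real.cos θ]

/-- The symbol of one step `U₂ U₁` of the walk. -/
def symbol (θ k : ℝ) : Matrix (Fin 2) (Fin 2) ℂ := symbol₂ θ k * symbol₁ θ k

theorem exp_ofReal_mul_I (k : ℝ) :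
    Complex.exp (k * Complex.I) = Real.cos k + Real.sin k * Complex.I := by
  rw [Complex.exp_mul_I, Complex.ofReal_cos, Complex.ofReal_sin]

theorem exp_neg_ofReal_mul_I (k : ℝ) :
    Complex.exp (-(k * Complex.I)) = Real.cos k - Real.sin k * Complex.I := by
  rw [← neg_mul, ← Complex.ofReal_neg, exp_ofReal_mul_I, Real.cos_neg, Real.sin_neg,
    Complex.ofReal_neg, neg_mul, sub_eq_add_neg]

theorem hasSymbol_U₁ (θ : ℝ) : HasSymbol (U₁ θ) (symbol₁ θ) := by
  rw [U₁]
  convert ((hasSymbol_hop _ _).add (hasSymbol_hop _ _)).add (hasSymbol_hop _ _) using 1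
  ext k i j
  fin_cases i <;> fin_cases j <;>
    simp [ketbra, symbol₁, exp_ofReal_mul_I, exp_neg_ofReal_mul_I, -Complex.ofReal_cos,
      -Complex.ofReal_sin] <;>
    ring

theorem hasSymbol_U₂ (θ : ℝ) : HasSymbol (U₂ θ) (symbol₂ θ) := by
  rw [U₂]
  convert ((hasSymbol_hop _ _).add (hasSymbol_hop _ _)).add (hasSymbol_hop _ _) using 1
  ext k i j
  fin_cases i <;> fin_cases j <;>
    simp [ketbra, symbol₂, exp_ofReal_mul_I, exp_neg_ofReal_mul_I, -Complex.ofReal_cos,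
      -Complex.ofReal_sin] <;>
    ring

theorem hasSymbol_step (θ : ℝ) : HasSymbol (U₂ θ ∘ₗ U₁ θ) (symbol θ) :=
  (hasSymbol_U₂ θ).comp (hasSymbol_U₁ θ)

theorem hasFiniteSupport_state (θ : ℝ) (α β : ℂ) (t : ℕ) :
    Function.HasFiniteSupport (state θ α β t : ℤ → Coin) := by
  induction t with
  | zero => exact (Set.finite_singleton (0 : ℤ)).subset Pi.support_single_subset
  | succ t ih => exact (hasSymbol_step θ).hasFiniteSupport ih

theorem fourierSum_state (θ : ℝ) (α β : ℂ) (t : ℕ) (k : ℝ) :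
    fourierSum (state θ α β t) k =
      Matrix.toEuclideanCLM (𝕜 := ℂ) (symbol θ k ^ t) !₂[α, β] := by
  induction t with
  | zero => rw [pow_zero, map_one]; exact fourierSum_single_zero _ k
  | succ t ih =>
    rw [pow_succ', map_mul, mul_apply_eq_comp, ← ih]
    exact (hasSymbol_step θ).fourierSum_apply (hasFiniteSupport_state θ α β t) k

theorem symbol₁_mem_unitaryGroup (θ k : ℝ) : symbol₁ θ k ∈ Matrix.unitaryGroup (Fin 2) ℂ := by
  have hθ := Complex.cos_sq_add_sin_sq θ
  have hk := Complex.cos_sq_add_sin_sq k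
  rw [Matrix.mem_unitaryGroup_iff, Matrix.star_eq_conjTranspose]
  ext i j
  fin_cases i <;> fin_cases j <;>
    simp [symbol₁, Matrix.mul_apply, Fin.sum_univ_two, ← Complex.cos_conj, ← Complex.sin_conj,
      Complex.conj_ofReal]
  all_goals ring_nf
  all_goals simp only [Complex.I_sq]
  all_goals linear_combination (Complex.cos θ) ^ 2 * hk + hθ

theorem symbol₂_mem_unitaryGroup (θ k : ℝ) : symbol₂ θ k ∈ Matrix.unitaryGroup (Fin 2) ℂ := by
  have hθ := Complex.cos_sq_add_sin_sq θ
  have hk := Complex.cos_sq_add_sin_sq k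
  rw [Matrix.mem_unitaryGroup_iff, Matrix.star_eq_conjTranspose]
  ext i j
  fin_cases i <;> fin_cases j <;>
    simp [symbol₂, Matrix.mul_apply, Fin.sum_univ_two, ← Complex.cos_conj, ← Complex.sin_conj,
      Complex.conj_ofReal]
  all_goals ring_nf
  all_goals simp only [Complex.I_sq]
  all_goals linear_combination (Complex.sin θ) ^ 2 * hk + hθ

theorem symbol_mem_unitaryGroup (θ k : ℝ) : symbol θ k ∈ Matrix.unitaryGroup (Fin 2) ℂ :=
  mul_mem (symbol₂_mem_unitaryGroup θ k) (symbol₁_mem_unitaryGroup θ k)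

section Expectation

variable {n : Type*} [Fintype n] [DecidableEq n]

/-- The expectation value `⟨φ, A φ⟩` of a matrix `A` in the state `φ`, as a linear form in `A`. -/
def expectation (φ : EuclideanSpace ℂ n) : Matrix n n ℂ →ₗ[ℂ] ℂ where
  toFun A := inner ℂ φ (Matrix.toEuclideanCLM (𝕜 := ℂ) A φ)
  map_add' A B := by rw [map_add, add_apply, inner_add_right]
  map_smul' c A := by
    rw [map_smul, smul_apply, inner_smul_right, RingHom.id_apply, smul_eq_mul]

theorem expectation_one (φ : EuclideanSpace ℂ n) : expectation φ 1 = ‖φ‖ ^ 2 := by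
  change inner ℂ φ (Matrix.toEuclideanCLM (𝕜 := ℂ) 1 φ) = _
  rw [map_one, one_apply_eq_self, inner_self_eq_norm_sq_to_K]
  rfl

theorem inner_toEuclideanCLM_toEuclideanCLM (A B : Matrix n n ℂ) (φ : EuclideanSpace ℂ n) :
    inner ℂ (Matrix.toEuclideanCLM (𝕜 := ℂ) A φ) (Matrix.toEuclideanCLM (𝕜 := ℂ) B φ) =
      expectation φ (star A * B) := by
  change _ = inner ℂ φ (Matrix.toEuclideanCLM (𝕜 := ℂ) (star A * B) φ)
  rw [map_mul, map_star, ContinuousLinearMap.star_eq_adjoint, mul_apply_eq_comp,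
    ContinuousLinearMap.adjoint_inner_right]

theorem norm_expectation_le (φ : EuclideanSpace ℂ n) {A : Matrix n n ℂ}
    (hA : A ∈ Matrix.unitaryGroup n ℂ) : ‖expectation φ A‖ ≤ ‖φ‖ ^ 2 :=
  calc ‖inner ℂ φ (Matrix.toEuclideanCLM (𝕜 := ℂ) A φ)‖
    _ ≤ ‖φ‖ * ‖Matrix.toEuclideanCLM (𝕜 := ℂ) A φ‖ := norm_inner_le_norm _ _
    _ = ‖φ‖ ^ 2 := by
      rw [ContinuousLinearMap.norm_map_of_mem_unitary
        (Unitary.map_mem Matrix.toEuclideanCLM hA), sq]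

theorem continuous_expectation (φ : EuclideanSpace ℂ n) : Continuous (expectation φ) :=
  LinearMap.continuous_of_finiteDimensional _

end Expectation

/-! ### The law of the position -/

theorem findingProb_eq (θ : ℝ) (α β : ℂ) (t : ℕ) (x : ℤ) :
    findingProb θ α β t x = ‖state θ α β t x‖ ^ 2 := by
  rw [findingProb, positionProj, lp.inner_single_right, inner_self_eq_norm_sq_to_K]
  norm_cast

theorem integral_law (θ : ℝ) (α β : ℂ) (t : ℕ) (f : ℤ → ℂ) :
    ∫ n, f n ∂(law θ α β t) =
      ∑ᶠ n, inner ℂ (state θ α β t n) (f n • state θ α β t n) := by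
  have summand (n : ℤ) : (ENNReal.ofReal (findingProb θ α β t n)).toReal • f n =
      inner ℂ (state θ α β t n) (f n • state θ α β t n) := by
    rw [findingProb_eq, ENNReal.toReal_ofReal (sq_nonneg _), inner_smul_right,
      inner_self_eq_norm_sq_to_K, Complex.real_smul, mul_comm, Complex.ofReal_pow]
    rfl
  rw [law, integral_sum_dirac fun _ => ENNReal.ofReal_ne_top, tsum_congr summand,
    tsum_eq_finsum]
  exact (hasFiniteSupport_state θ α β t).subset fun n hn h => hn (by simp [h])

theorem charFun_law (θ : ℝ) (α β : ℂ) (t : ℕ) (η : ℝ) :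
    charFun ((law θ α β t).map ((↑) : ℤ → ℝ)) η = (2 * Real.pi : ℂ)⁻¹ *
      ∫ k in (-Real.pi)..Real.pi,
        expectation !₂[α, β] (star (symbol θ k ^ t) * symbol θ (k - η) ^ t) := by
  have support : Function.HasFiniteSupport (state θ α β t : ℤ → Coin) :=
    hasFiniteSupport_state θ α β t
  have modulated : Function.HasFiniteSupport
      fun x : ℤ => Complex.exp (η * x * Complex.I) • (state θ α β t : ℤ → Coin) x :=
    .fun_smul_right _ support
  rw [charFun_apply_real, integral_map Measurable.of_discrete.aemeasurable
    (Continuous.aestronglyMeasurable (by fun_prop)),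
    eq_inv_mul_iff_mul_eq₀ (by simp [Real.pi_ne_zero])]
  simp only [Complex.ofReal_intCast, integral_law, ← inner_toEuclideanCLM_toEuclideanCLM,
    ← fourierSum_state, fourierSum_sub]
  rw [integral_inner_fourierSum support modulated]

theorem isProbabilityMeasure_law (θ : ℝ) {α β : ℂ} (hαβ : ‖α‖ ^ 2 + ‖β‖ ^ 2 = 1) (t : ℕ) :
    IsProbabilityMeasure (law θ α β t) := by
  have norm_sq : ‖!₂[α, β]‖ ^ 2 = 1 := by simpa [EuclideanSpace.norm_sq_eq] using hαβ
  have unitarity (k : ℝ) : star (symbol θ k ^ t) * symbol θ k ^ t = 1 :=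
    (Unitary.mem_iff.1 (pow_mem (symbol_mem_unitaryGroup θ k) t)).1
  have integrand (k : ℝ) :
      expectation !₂[α, β] (star (symbol θ k ^ t) * symbol θ (k - 0) ^ t) = 1 := by
    rw [sub_zero, unitarity, expectation_one]
    exact_mod_cast norm_sq
  have total : charFun ((law θ α β t).map ((↑) : ℤ → ℝ)) 0 = 1 := by
    have pi_ne_zero : (Real.pi : ℂ) ≠ 0 := by exact_mod_cast Real.pi_ne_zero
    simp only [charFun_law, integrand, intervalIntegral.integral_const, sub_neg_eq_add,
      Complex.real_smul, Complex.ofReal_add]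
    field_simp
    norm_num
  rw [charFun_zero, map_measureReal_apply .of_discrete .univ, Set.preimage_univ] at total
  exact ⟨(ENNReal.toReal_eq_one_iff _).1 (by exact_mod_cast total)⟩

/-! ### The gauge symmetry `θ ↦ π - θ` -/

theorem hop_apply (d : ℤ) (A : Matrix (Fin 2) (Fin 2) ℂ) (Ψ : Space) (x : ℤ) :
    hop d A Ψ x = Matrix.toEuclideanCLM (𝕜 := ℂ) A (Ψ (x - d)) :=
  rfl

theorem U₁_pi_sub_apply (θ : ℝ) {c : ℂ} {Φ Ψ : Space} (h : ∀ x, Φ x = (c * (-1) ^ x) • Ψ x)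
    (x : ℤ) : U₁ (Real.pi - θ) Φ x = (c * (-1) ^ x) • U₁ θ Ψ x := by
  have neg_one_ne_zero : (-1 : ℂ) ≠ 0 := neg_ne_zero.2 one_ne_zero
  simp only [U₁, LinearMap.add_apply, lp.coeFn_add, Pi.add_apply, hop_apply, h, map_smul,
    smul_apply, Real.cos_pi_sub, Real.sin_pi_sub, sub_neg_eq_add, sub_zero,
    zpow_sub_one₀ neg_one_ne_zero, zpow_add_one₀ neg_one_ne_zero, inv_neg_one, neg_div,
    Complex.ofReal_neg]
  module

theorem U₂_pi_sub_apply (θ : ℝ) {c : ℂ} {Φ Ψ : Space} (h : ∀ x, Φ x = (c * (-1) ^ x) • Ψ x)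
    (x : ℤ) : U₂ (Real.pi - θ) Φ x = (-c * (-1) ^ x) • U₂ θ Ψ x := by
  have neg_one_ne_zero : (-1 : ℂ) ≠ 0 := neg_ne_zero.2 one_ne_zero
  simp only [U₂, LinearMap.add_apply, lp.coeFn_add, Pi.add_apply, hop_apply, h, map_smul,
    smul_apply, Real.cos_pi_sub, Real.sin_pi_sub, sub_neg_eq_add, sub_zero,
    zpow_sub_one₀ neg_one_ne_zero, zpow_add_one₀ neg_one_ne_zero, inv_neg_one,
    Complex.ofReal_neg]
  module

theorem state_pi_sub_apply (θ : ℝ) (α β : ℂ) (t : ℕ) (x : ℤ) :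
    state (Real.pi - θ) α β t x = ((-1) ^ t * (-1) ^ x : ℂ) • state θ α β t x := by
  induction t generalizing x with
  | zero =>
    obtain rfl | hx := eq_or_ne x 0
    · rw [pow_zero, zpow_zero, mul_one, one_smul]
      rfl
    · rw [state, state, lp.single_apply_ne _ _ _ hx, smul_zero]
  | succ t ih =>
    rw [pow_succ, mul_neg_one]
    exact U₂_pi_sub_apply θ (U₁_pi_sub_apply θ ih) x

theorem law_pi_sub (θ : ℝ) (α β : ℂ) (t : ℕ) : law (Real.pi - θ) α β t = law θ α β t := by
  simp only [law, findingProb_eq, state_pi_sub_apply, norm_smul, norm_mul, norm_pow, norm_zpow,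
    norm_neg, norm_one, one_pow, one_zpow, one_mul]

/-! ### Powers of phase rotations -/

section PhaseRotation

section Algebra

variable {A : Type*} [Ring A] [Algebra ℂ A] {N : A}

/-- For `N ^ 2 = 1` this is the exponential `exp (i a N)`. -/
def phaseRotation (N : A) (a : ℝ) : A := (Real.cos a : ℂ) • 1 + (Real.sin a * Complex.I) • N

theorem phaseRotation_zero (N : A) : phaseRotation N 0 = 1 := by simp [phaseRotation]

theorem phaseRotation_mul_phaseRotation (hN : N * N = 1) (a b : ℝ) :
    phaseRotation N a * phaseRotation N b = phaseRotation N (a + b) := by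
  have sin_mul_sin : (Real.sin a * Complex.I) * (Real.sin b * Complex.I) =
      -(Real.sin a * Real.sin b) := by
    linear_combination (Real.sin a * Real.sin b : ℂ) * Complex.I_sq
  simp only [phaseRotation, add_mul, mul_add, smul_mul_smul_comm, one_mul, mul_one, hN,
    sin_mul_sin, Real.cos_add, Real.sin_add, Complex.ofReal_add, Complex.ofReal_sub,
    Complex.ofReal_mul]
  module

theorem phaseRotation_pow (hN : N * N = 1) (a : ℝ) (t : ℕ) :
    phaseRotation N a ^ t = phaseRotation N (t * a) := by
  induction t with
  | zero => rw [pow_zero, Nat.cast_zero, zero_mul, phaseRotation_zero]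
  | succ t ih =>
    rw [pow_succ, ih, phaseRotation_mul_phaseRotation hN, Nat.cast_succ, add_one_mul]

theorem star_phaseRotation [StarRing A] [StarModule ℂ A] (hN : star N = N) (a : ℝ) :
    star (phaseRotation N a) = phaseRotation N (-a) := by
  simp only [phaseRotation, star_add, star_smul, star_one, hN, star_mul', RCLike.star_def,
    Complex.conj_ofReal, Complex.conj_I, Real.cos_neg, Real.sin_neg, Complex.ofReal_neg,
    mul_neg, neg_mul]

theorem phaseRotation_sub_phaseRotation (N N' : A) (a : ℝ) :
    phaseRotation N a - phaseRotation N' a = (Real.sin a * Complex.I) • (N - N') := by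
  rw [phaseRotation, phaseRotation, add_sub_add_left_eq_sub, smul_sub]

end Algebra

section Limit

variable {A : Type*} [NormedRing A] [NormedAlgebra ℂ A]

theorem continuous_phaseRotation (N : A) : Continuous (phaseRotation N) := by
  unfold phaseRotation
  fun_prop

theorem norm_phaseRotation_le (N : A) (a : ℝ) : ‖phaseRotation N a‖ ≤ ‖(1 : A)‖ + ‖N‖ := by
  have hcos : ‖(Real.cos a : ℂ)‖ ≤ 1 := by
    rw [Complex.norm_real]; exact Real.abs_cos_le_one a
  have hsin : ‖(Real.sin a * Complex.I : ℂ)‖ ≤ 1 := by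
    rw [norm_mul, Complex.norm_I, mul_one, Complex.norm_real]; exact Real.abs_sin_le_one a
  refine (norm_add_le _ _).trans (add_le_add ?_ ?_) <;> rw [norm_smul]
  · exact mul_le_of_le_one_left (norm_nonneg _) hcos
  · exact mul_le_of_le_one_left (norm_nonneg _) hsin

theorem tendsto_nat_mul_sub {ω : ℝ → ℝ} {v k : ℝ} (hω : HasDerivAt ω v k) (ξ : ℝ) :
    Tendsto (fun t : ℕ => t * (ω (k - ξ / t) - ω k)) atTop (𝓝 (-(ξ * v))) := by
  have scale : Tendsto (fun t : ℕ => ‖(t : ℝ)‖) atTop atTop :=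
    tendsto_norm_atTop_atTop.comp tendsto_natCast_atTop_atTop
  simpa [div_eq_inv_mul, sub_eq_add_neg] using hω.hasFDerivAt.lim (-ξ) scale

theorem tendsto_star_pow_mul_pow [StarRing A] [StarModule ℂ A] {M N : ℝ → A} {ω : ℝ → ℝ}
    {v k : ℝ} (hM : M =ᶠ[𝓝 k] fun l => phaseRotation (N l) (ω l)) (hsq : ∀ l, N l * N l = 1)
    (hstar : star (N k) = N k) (hcont : ContinuousAt N k) (hω : HasDerivAt ω v k) (ξ : ℝ) :
    Tendsto (fun t : ℕ => star (M k ^ t) * M (k - ξ / t) ^ t) atTop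
      (𝓝 (phaseRotation (N k) (-(ξ * v)))) := by
  have momentum : Tendsto (fun t : ℕ => k - ξ / t) atTop (𝓝 k) := by
    simpa using tendsto_const_nhds.sub (tendsto_const_div_atTop_nhds_zero_nat ξ)
  have rotation : Tendsto (fun t : ℕ => phaseRotation (N k) (t * (ω (k - ξ / t) - ω k))) atTop
      (𝓝 (phaseRotation (N k) (-(ξ * v)))) :=
    ((continuous_phaseRotation _).tendsto _).comp (tendsto_nat_mul_sub hω ξ)
  have axis_change : Tendsto (fun t : ℕ => N (k - ξ / t) - N k) atTop (𝓝 0) := by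
    simpa using (hcont.tendsto.comp momentum).sub_const (N k)
  have remainder : Tendsto (fun t : ℕ => phaseRotation (N k) (-(t * ω k)) *
      ((Real.sin (t * ω (k - ξ / t)) * Complex.I) • (N (k - ξ / t) - N k))) atTop (𝓝 0) := by
    refine squeeze_zero_norm (fun t => ?_)
      (by simpa using axis_change.norm.const_mul (‖(1 : A)‖ + ‖N k‖))
    refine norm_mul_le_of_le (norm_phaseRotation_le _ _) ?_
    rw [norm_smul, norm_mul, Complex.norm_I, mul_one, Complex.norm_real]
    exact mul_le_of_le_one_left (norm_nonneg _) (Real.abs_sin_le_one _)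
  rw [← add_zero (phaseRotation (N k) (-(ξ * v)))]
  refine (rotation.add remainder).congr' ?_
  filter_upwards [momentum.eventually hM] with t ht
  rw [ht, hM.self_of_nhds, phaseRotation_pow (hsq _), phaseRotation_pow (hsq _),
    star_phaseRotation hstar, ← phaseRotation_sub_phaseRotation, mul_sub,
    mul_sub, phaseRotation_mul_phaseRotation (hsq k), neg_add_eq_sub, add_sub_cancel]

end Limit

end PhaseRotation

/-! ### The group velocity -/

theorem one_add_sin_sq_pos (x : ℝ) : 0 < 1 + Real.sin x ^ 2 := by positivity

theorem cos_half_pos {k : ℝ} (hk : k ∈ Set.Ioo (-Real.pi) Real.pi) : 0 < Real.cos (k / 2) :=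
  Real.cos_pos_of_mem_Ioo ⟨by linarith [hk.1], by linarith [hk.2]⟩

theorem hasDerivAt_sin_half (k : ℝ) :
    HasDerivAt (fun k : ℝ => Real.sin (k / 2)) (Real.cos (k / 2) / 2) k := by
  simpa [div_eq_mul_inv] using ((hasDerivAt_id k).div_const 2).sin

/-- The group velocity at momentum `k` for the parameter `θ = π / 4`, that is, the derivative of
the dispersion relation. -/
def velocity (k : ℝ) : ℝ := 2 * Real.sin (k / 2) / √(1 + Real.sin (k / 2) ^ 2)

theorem hasDerivAt_velocity (k : ℝ) : HasDerivAt velocity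
    (Real.cos (k / 2) / ((1 + Real.sin (k / 2) ^ 2) * √(1 + Real.sin (k / 2) ^ 2))) k := by
  have radicand_pos := one_add_sin_sq_pos (k / 2)
  have root_ne_zero := (Real.sqrt_pos.2 radicand_pos).ne'
  have root_sq := Real.sq_sqrt radicand_pos.le
  have root := (((hasDerivAt_sin_half k).fun_pow 2).const_add 1).sqrt radicand_pos.ne'
  refine (((hasDerivAt_sin_half k).const_mul 2).fun_div root root_ne_zero).congr_deriv ?_
  generalize √(1 + Real.sin (k / 2) ^ 2) = r at *
  rw [← root_sq]
  field_simp
  push_cast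
  linear_combination 2 * Real.cos (k / 2) * root_sq

theorem continuous_velocity : Continuous velocity :=
  continuous_iff_continuousAt.2 fun k => (hasDerivAt_velocity k).continuousAt

theorem velocity_neg (k : ℝ) : velocity (-k) = -velocity k := by
  simp [velocity, neg_div]

theorem velocity_pi : velocity Real.pi = √2 := by
  rw [velocity, Real.sin_pi_div_two, mul_one, one_pow, one_add_one_eq_two, Real.div_sqrt]

theorem velocity_sq (k : ℝ) :
    velocity k ^ 2 = 4 * Real.sin (k / 2) ^ 2 / (1 + Real.sin (k / 2) ^ 2) := by
  rw [velocity, div_pow, Real.sq_sqrt (one_add_sin_sq_pos _).le]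
  ring

theorem strictMonoOn_velocity : StrictMonoOn velocity (Set.Icc (-Real.pi) Real.pi) := by
  refine strictMonoOn_of_deriv_pos (convex_Icc _ _) continuous_velocity.continuousOn fun k hk => ?_
  rw [interior_Icc] at hk
  rw [(hasDerivAt_velocity k).deriv]
  have := cos_half_pos hk
  have := one_add_sin_sq_pos (k / 2)
  positivity

theorem velocity_image_Ioo : velocity '' Set.Ioo (-Real.pi) Real.pi = Set.Ioo (-√2) √2 := by
  rw [continuous_velocity.continuousOn.image_Ioo_of_strictMonoOn (by linarith [Real.pi_pos])
    strictMonoOn_velocity, velocity_neg, velocity_pi]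

/-! ### The limit density -/

/-- The coefficient `|α|² - |β|² + α β̄ + ᾱ β` of the asymmetric part of the limit density. -/
def bias (α β : ℂ) : ℝ := ‖α‖ ^ 2 - ‖β‖ ^ 2 + (α * conj β + conj α * β).re

theorem bias_sq_le {α β : ℂ} (hαβ : ‖α‖ ^ 2 + ‖β‖ ^ 2 = 1) : bias α β ^ 2 ≤ 2 := by
  obtain ⟨a, b⟩ := α
  obtain ⟨c, d⟩ := β
  simp only [bias, Complex.sq_norm, Complex.normSq_mk, Complex.add_re, Complex.mul_re,
    Complex.conj_re, Complex.conj_im] at hαβ ⊢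
  -- The Bloch vector of a normalized coin state is a unit vector.
  have bloch : (a * a + b * b - (c * c + d * d)) ^ 2 + (2 * (a * c + b * d)) ^ 2 +
      (2 * (a * d - b * c)) ^ 2 = 1 := by
    linear_combination (a * a + b * b + (c * c + d * d) + 1) * hαβ
  nlinarith [sq_nonneg (a * a + b * b - (c * c + d * d) - 2 * (a * c + b * d)),
    sq_nonneg (2 * (a * d - b * c))]

theorem limitDensity_pos {α β : ℂ} (hαβ : ‖α‖ ^ 2 + ‖β‖ ^ 2 = 1) {y : ℝ}
    (hy : y ∈ Set.Ioo (-√2) √2) : 0 < limitDensity α β y := by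
  have y_sq_lt : y ^ 2 < 2 := Real.sq_lt.2 hy
  have : 0 < 4 - y ^ 2 := by linarith
  have : 0 < √(2 - y ^ 2) := Real.sqrt_pos.2 (by linarith)
  rw [limitDensity, Set.indicator_of_mem hy, ← bias]
  refine mul_pos (by positivity) ?_
  nlinarith [sq_nonneg (bias α β - y), bias_sq_le hαβ]

theorem limitDensity_nonneg {α β : ℂ} (hαβ : ‖α‖ ^ 2 + ‖β‖ ^ 2 = 1) (y : ℝ) :
    0 ≤ limitDensity α β y := by
  by_cases hy : y ∈ Set.Ioo (-√2) √2
  · exact (limitDensity_pos hαβ hy).le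
  · rw [limitDensity, Set.indicator_of_notMem hy]

theorem limitDensity_eq_indicator (α β : ℂ) :
    limitDensity α β = (velocity '' Set.Ioo (-Real.pi) Real.pi).indicator (limitDensity α β) := by
  rw [limitDensity, velocity_image_Ioo, Set.indicator_indicator, Set.inter_self]

theorem deriv_velocity_mul_limitDensity (α β : ℂ) {k : ℝ} (hk : k ∈ Set.Ioo (-Real.pi) Real.pi) :
    Real.cos (k / 2) / ((1 + Real.sin (k / 2) ^ 2) * √(1 + Real.sin (k / 2) ^ 2)) *
      limitDensity α β (velocity k) = (2 * Real.pi)⁻¹ * (1 - bias α β * (velocity k / 2)) := by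
  have := cos_half_pos hk
  have radicand_pos := one_add_sin_sq_pos (k / 2)
  have root_sq := Real.sq_sqrt radicand_pos.le
  have velocity_mem : velocity k ∈ Set.Ioo (-√2) √2 :=
    velocity_image_Ioo ▸ Set.mem_image_of_mem _ hk
  have four_sub : 4 - velocity k ^ 2 = 4 / (1 + Real.sin (k / 2) ^ 2) := by
    rw [velocity_sq]
    field_simp
    ring
  have two_sub : 2 - velocity k ^ 2 =
      2 * (Real.cos (k / 2) / √(1 + Real.sin (k / 2) ^ 2)) ^ 2 := by
    rw [velocity_sq, div_pow, root_sq, Real.cos_sq']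
    field_simp
    ring
  rw [limitDensity, Set.indicator_of_mem velocity_mem, ← bias, four_sub, two_sub,
    Real.sqrt_mul zero_le_two, Real.sqrt_sq (by positivity), ← mul_assoc]
  congr 1
  field_simp
  norm_num

theorem integrable_limitDensity (α β : ℂ) : Integrable (limitDensity α β) := by
  have hv := continuous_velocity
  rw [limitDensity_eq_indicator, velocity_image_Ioo, integrable_indicator_iff measurableSet_Ioo,
    ← velocity_image_Ioo, integrableOn_image_iff_integrableOn_deriv_smul_of_monotoneOn
    measurableSet_Ioo (fun k _ => (hasDerivAt_velocity k).hasDerivWithinAt)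
    (strictMonoOn_velocity.monotoneOn.mono Set.Ioo_subset_Icc_self)]
  refine IntegrableOn.congr_fun (Continuous.integrableOn_Icc (by fun_prop) |>.mono_set
    Set.Ioo_subset_Icc_self) (fun k hk => (deriv_velocity_mul_limitDensity α β hk).symm)
    measurableSet_Ioo

section ChangeOfVariables

variable {E : Type*} [NormedAddCommGroup E] [NormedSpace ℝ E]

theorem integral_limitDensity_smul (α β : ℂ) (f : ℝ → E) :
    ∫ y, limitDensity α β y • f y = (2 * Real.pi)⁻¹ •
      ∫ k in (-Real.pi)..Real.pi, (1 - bias α β * (velocity k / 2)) • f (velocity k) := by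
  have restrict : ∫ y, limitDensity α β y • f y =
      ∫ y in velocity '' Set.Ioo (-Real.pi) Real.pi, limitDensity α β y • f y := by
    rw [velocity_image_Ioo, ← integral_indicator measurableSet_Ioo, Set.indicator_smul_left,
      ← velocity_image_Ioo, ← limitDensity_eq_indicator]
  rw [restrict, integral_image_eq_integral_deriv_smul_of_monotoneOn measurableSet_Ioo
    (fun k _ => (hasDerivAt_velocity k).hasDerivWithinAt)
    (strictMonoOn_velocity.monotoneOn.mono Set.Ioo_subset_Icc_self),
    intervalIntegral.integral_of_le (by linarith [Real.pi_pos]), integral_Ioc_eq_integral_Ioo,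
    ← integral_smul]
  refine setIntegral_congr_fun measurableSet_Ioo fun k hk => ?_
  rw [smul_smul, smul_smul, deriv_velocity_mul_limitDensity α β hk]

theorem integral_eq_zero_of_odd {f : ℝ → E} (hf : f.Odd) (a : ℝ) : ∫ k in (-a)..a, f k = 0 := by
  have reflected := intervalIntegral.integral_comp_neg (a := -a) (b := a) f
  simp only [hf _, intervalIntegral.integral_neg, neg_neg] at reflected
  have := IsAddTorsionFree.of_isTorsionFree ℝ E
  exact self_eq_neg.1 reflected.symm

end ChangeOfVariables

theorem integral_limitDensity (α β : ℂ) : ∫ y, limitDensity α β y = 1 := by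
  have hv := continuous_velocity
  have odd : ∫ k in (-Real.pi)..Real.pi, bias α β * (velocity k / 2) = 0 :=
    integral_eq_zero_of_odd (fun k => by rw [velocity_neg]; ring) _
  have substituted := integral_limitDensity_smul α β fun _ => (1 : ℝ)
  simp only [smul_eq_mul, mul_one] at substituted
  rw [substituted, intervalIntegral.integral_sub intervalIntegrable_const
    (Continuous.intervalIntegrable (by fun_prop) _ _), odd, intervalIntegral.integral_const]
  simp only [sub_neg_eq_add, smul_eq_mul, mul_one, sub_zero]
  field_simp
  norm_num

/-! ### Spectral decomposition of the symbol at `θ = π / 4` -/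

/-- The dispersion relation: at `θ = π / 4` the eigenvalues of the symbol at momentum `k` are
`exp (± i dispersion k)`. -/
def dispersion (k : ℝ) : ℝ := 2 * Real.arcsin (Real.sin (k / 2) ^ 2)

theorem sin_arcsin_sin_sq (x : ℝ) : Real.sin (Real.arcsin (Real.sin x ^ 2)) = Real.sin x ^ 2 :=
  Real.sin_arcsin (by linarith [sq_nonneg (Real.sin x)]) (Real.sin_sq_le_one x)

theorem sqrt_one_sub_sin_pow_four {k : ℝ} (hk : k ∈ Set.Ioo (-Real.pi) Real.pi) :
    √(1 - (Real.sin (k / 2) ^ 2) ^ 2) = Real.cos (k / 2) * √(1 + Real.sin (k / 2) ^ 2) := by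
  have factored : 1 - (Real.sin (k / 2) ^ 2) ^ 2 =
      Real.cos (k / 2) ^ 2 * (1 + Real.sin (k / 2) ^ 2) := by
    rw [Real.cos_sq']
    ring
  rw [factored, Real.sqrt_mul (sq_nonneg _), Real.sqrt_sq (cos_half_pos hk).le]

theorem cos_dispersion (k : ℝ) : Real.cos (dispersion k) = 1 - 2 * Real.sin (k / 2) ^ 4 := by
  rw [dispersion, Real.cos_two_mul_eq_one_sub, sin_arcsin_sin_sq]
  ring

theorem sin_dispersion {k : ℝ} (hk : k ∈ Set.Ioo (-Real.pi) Real.pi) :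
    Real.sin (dispersion k) =
      2 * Real.sin (k / 2) ^ 2 * Real.cos (k / 2) * √(1 + Real.sin (k / 2) ^ 2) := by
  rw [dispersion, Real.sin_two_mul, sin_arcsin_sin_sq, Real.cos_arcsin,
    sqrt_one_sub_sin_pow_four hk]
  ring

theorem hasDerivAt_dispersion {k : ℝ} (hk : k ∈ Set.Ioo (-Real.pi) Real.pi) :
    HasDerivAt dispersion (velocity k) k := by
  have := cos_half_pos hk
  have := Real.sqrt_pos.2 (one_add_sin_sq_pos (k / 2))
  have sin_sq_lt_one : Real.sin (k / 2) ^ 2 < 1 := by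
    nlinarith [Real.sin_sq_add_cos_sq (k / 2)]
  refine (((Real.hasDerivAt_arcsin (by linarith [sq_nonneg (Real.sin (k / 2))])
    sin_sq_lt_one.ne).comp k ((hasDerivAt_sin_half k).pow 2)).const_mul 2).congr_deriv ?_
  rw [sqrt_one_sub_sin_pow_four hk, velocity]
  field_simp
  norm_num

/-- The unnormalized Hermitian generator of the symbol at momentum `k`. -/
def generator (k : ℝ) : Matrix (Fin 2) (Fin 2) ℂ :=
  !![(Real.sin (k / 2) : ℂ), Real.sin (k / 2) - Real.cos (k / 2) * Complex.I;
    Real.sin (k / 2) + Real.cos (k / 2) * Complex.I, -Real.sin (k / 2)]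

theorem ofReal_cos_sq' (x : ℝ) : (Real.cos x : ℂ) ^ 2 = 1 - (Real.sin x : ℂ) ^ 2 := by
  exact_mod_cast Real.cos_sq' x

theorem generator_mul_self (k : ℝ) :
    generator k * generator k = ((1 + Real.sin (k / 2) ^ 2 : ℝ) : ℂ) • 1 := by
  have cos_sq := ofReal_cos_sq' (k / 2)
  have I_sq := Complex.I_sq
  rw [generator, Complex.ofReal_add, Complex.ofReal_pow, Complex.ofReal_one]
  generalize (Real.sin (k / 2) : ℂ) = s at *
  generalize (Real.cos (k / 2) : ℂ) = c at *
  generalize Complex.I = i at *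
  ext a b
  fin_cases a <;> fin_cases b <;> simp <;> grind

theorem star_generator (k : ℝ) : star (generator k) = generator k := by
  rw [Matrix.star_eq_conjTranspose]
  ext i j
  fin_cases i <;> fin_cases j <;>
    simp [generator, -Complex.ofReal_cos, -Complex.ofReal_sin, sub_eq_add_neg]

theorem symbol_pi_div_four_eq_generator (k : ℝ) : symbol (Real.pi / 4) k =
    (1 - 2 * Real.sin (k / 2) ^ 4 : ℂ) • 1 +
      (2 * Real.sin (k / 2) ^ 2 * Real.cos (k / 2) * Complex.I) • generator k := by
  have sqrt_two_sq : ((√2 / 2 : ℝ) : ℂ) ^ 2 = 1 / 2 := by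
    norm_cast
    rw [div_pow, Real.sq_sqrt zero_le_two]
    norm_num
  have sin_eq : Real.sin k = 2 * Real.sin (k / 2) * Real.cos (k / 2) := by
    rw [← Real.sin_two_mul, mul_div_cancel₀ k two_ne_zero]
  have cos_eq : Real.cos k = 1 - 2 * Real.sin (k / 2) ^ 2 := by
    rw [← Real.cos_two_mul_eq_one_sub, mul_div_cancel₀ k two_ne_zero]
  have cos_sq := ofReal_cos_sq' (k / 2)
  have I_sq := Complex.I_sq
  rw [symbol, symbol₁, symbol₂, generator, Real.cos_pi_div_four, Real.sin_pi_div_four, sin_eq,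
    cos_eq]
  simp only [Complex.ofReal_sub, Complex.ofReal_mul, Complex.ofReal_pow, Complex.ofReal_one,
    Complex.ofReal_ofNat]
  generalize ((√2 / 2 : ℝ) : ℂ) = r at *
  generalize (Real.sin (k / 2) : ℂ) = s at *
  generalize (Real.cos (k / 2) : ℂ) = c at *
  generalize Complex.I = i at *
  ext a b
  fin_cases a <;> fin_cases b <;> simp [Matrix.mul_apply, Fin.sum_univ_two] <;> grind

/-- The Hermitian involution `N` with symbol `exp (i dispersion k N)` at momentum `k`. -/
def axis (k : ℝ) : Matrix (Fin 2) (Fin 2) ℂ :=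
  (((√(1 + Real.sin (k / 2) ^ 2))⁻¹ : ℝ) : ℂ) • generator k

theorem axis_mul_self (k : ℝ) : axis k * axis k = 1 := by
  have radicand_pos := one_add_sin_sq_pos (k / 2)
  rw [axis, smul_mul_smul_comm, generator_mul_self, smul_smul, ← Complex.ofReal_mul,
    ← Complex.ofReal_mul, ← mul_inv, Real.mul_self_sqrt radicand_pos.le,
    inv_mul_cancel₀ radicand_pos.ne', Complex.ofReal_one, one_smul]

theorem star_axis (k : ℝ) : star (axis k) = axis k := by
  rw [axis, star_smul, star_generator, RCLike.star_def, Complex.conj_ofReal]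

theorem continuous_matrix_of_fin_two {X : Type*} [TopologicalSpace X] {a b c d : X → ℂ}
    (ha : Continuous a) (hb : Continuous b) (hc : Continuous c) (hd : Continuous d) :
    Continuous fun x => !![a x, b x; c x, d x] := by
  refine continuous_matrix fun i j => ?_
  fin_cases i <;> fin_cases j <;> assumption

theorem continuous_axis : Continuous axis := by
  have root_ne_zero (k : ℝ) : √(1 + Real.sin (k / 2) ^ 2) ≠ 0 :=
    (Real.sqrt_pos.2 (one_add_sin_sq_pos (k / 2))).ne'
  have entries : Continuous generator :=
    continuous_matrix_of_fin_two (by fun_prop) (by fun_prop) (by fun_prop) (by fun_prop)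
  unfold axis
  fun_prop (disch := exact root_ne_zero _)

theorem symbol_pi_div_four {k : ℝ} (hk : k ∈ Set.Ioo (-Real.pi) Real.pi) :
    symbol (Real.pi / 4) k = phaseRotation (axis k) (dispersion k) := by
  have root_ne_zero : (√(1 + Real.sin (k / 2) ^ 2) : ℂ) ≠ 0 := by
    exact_mod_cast (Real.sqrt_pos.2 (one_add_sin_sq_pos (k / 2))).ne'
  rw [symbol_pi_div_four_eq_generator, phaseRotation, axis, smul_smul, cos_dispersion,
    sin_dispersion hk]
  congr 2
  · push_cast
    rfl
  · push_cast at root_ne_zero ⊢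
    field_simp

theorem expectation_axis (α β : ℂ) (k : ℝ) :
    expectation !₂[α, β] (axis k) = bias α β * (velocity k / 2) +
      (Real.cos (k / 2) / √(1 + Real.sin (k / 2) ^ 2) : ℝ) *
        ((α * conj β - conj α * β) * Complex.I) := by
  have bias_eq : (bias α β : ℂ) = α * conj α - β * conj β + (α * conj β + conj α * β) := by
    have cross_real : ((α * conj β + conj α * β).re : ℂ) = α * conj β + conj α * β := by
      rw [← Complex.conj_eq_iff_re]
      simp only [map_add, map_mul, Complex.conj_conj]
      ring
    rw [bias, Complex.ofReal_add, cross_real, Complex.ofReal_sub, Complex.ofReal_pow,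
      Complex.ofReal_pow, Complex.mul_conj', Complex.mul_conj']
  rw [bias_eq, velocity, axis, map_smul]
  simp [expectation, generator, PiLp.inner_apply, Fin.sum_univ_two]
  ring

/-! ### Convergence of the characteristic functions -/

theorem continuous_symbol (θ : ℝ) : Continuous (symbol θ) :=
  .mul (continuous_matrix_of_fin_two (by fun_prop) (by fun_prop) (by fun_prop) (by fun_prop))
    (continuous_matrix_of_fin_two (by fun_prop) (by fun_prop) (by fun_prop) (by fun_prop))

open scoped Matrix.Norms.L2Operator in
theorem tendsto_star_symbol_pow_mul_symbol_pow {k : ℝ} (hk : k ∈ Set.Ioo (-Real.pi) Real.pi)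
    (ξ : ℝ) :
    Tendsto (fun t : ℕ => star (symbol (Real.pi / 4) k ^ t) * symbol (Real.pi / 4) (k - ξ / t) ^ t)
      atTop (𝓝 (phaseRotation (axis k) (-(ξ * velocity k)))) :=
  tendsto_star_pow_mul_pow
    (eventually_of_mem (isOpen_Ioo.mem_nhds hk) fun _ => symbol_pi_div_four) axis_mul_self
    (star_axis k) continuous_axis.continuousAt (hasDerivAt_dispersion hk) ξ

theorem expectation_phaseRotation {n : Type*} [Fintype n] [DecidableEq n]
    {φ : EuclideanSpace ℂ n} (hφ : ‖φ‖ = 1) (N : Matrix n n ℂ) (a : ℝ) :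
    expectation φ (phaseRotation N a) = Real.cos a + Real.sin a * Complex.I * expectation φ N := by
  rw [phaseRotation, map_add, map_smul, map_smul, expectation_one, hφ, smul_eq_mul, smul_eq_mul]
  norm_num

theorem integral_expectation_phaseRotation_axis {α β : ℂ} (hφ : ‖(!₂[α, β] : Coin)‖ = 1) (ξ : ℝ) :
    ∫ k in (-Real.pi)..Real.pi,
        expectation !₂[α, β] (phaseRotation (axis k) (-(ξ * velocity k))) =
      ∫ k in (-Real.pi)..Real.pi,
        (1 - bias α β * (velocity k / 2)) • Complex.exp (ξ * velocity k * Complex.I) := by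
  have hv := continuous_velocity
  have hN : Continuous fun k => expectation !₂[α, β] (axis k) :=
    (continuous_expectation _).comp continuous_axis
  have exp_eq (k : ℝ) : Complex.exp (ξ * velocity k * Complex.I) =
      Real.cos (ξ * velocity k) + Real.sin (ξ * velocity k) * Complex.I := by
    rw [← Complex.ofReal_mul, exp_ofReal_mul_I]
  simp only [expectation_phaseRotation hφ, exp_eq, Complex.real_smul]
  -- The two integrands agree up to an odd function of `k`.
  rw [← sub_eq_zero, ← intervalIntegral.integral_sub
    (Continuous.intervalIntegrable (by fun_prop) _ _)
    (Continuous.intervalIntegrable (by fun_prop) _ _)]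
  refine integral_eq_zero_of_odd (fun k => ?_) _
  simp only [expectation_axis, velocity_neg, mul_neg, neg_neg, Real.cos_neg, Real.sin_neg, neg_div,
    neg_sq]
  push_cast
  ring

theorem tendsto_charFun_law {α β : ℂ} (hαβ : ‖α‖ ^ 2 + ‖β‖ ^ 2 = 1) (ξ : ℝ) :
    Tendsto (fun t : ℕ => charFun ((law (Real.pi / 4) α β t).map fun n : ℤ => (n : ℝ) / t) ξ)
      atTop (𝓝 (∫ y, limitDensity α β y • Complex.exp (ξ * y * Complex.I))) := by
  have hφ : ‖(!₂[α, β] : Coin)‖ = 1 := by simp [EuclideanSpace.norm_eq, hαβ]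
  have rescaled (t : ℕ) : charFun ((law (Real.pi / 4) α β t).map fun n : ℤ => (n : ℝ) / t) ξ =
      charFun ((law (Real.pi / 4) α β t).map ((↑) : ℤ → ℝ)) (ξ / t) := by
    simp only [div_eq_inv_mul]
    exact charFun_map_mul_comp Measurable.of_discrete.aemeasurable _ _
  simp only [rescaled, charFun_law]
  rw [integral_limitDensity_smul, ← integral_expectation_phaseRotation_axis hφ, Complex.real_smul]
  push_cast
  refine .const_mul _ (intervalIntegral.tendsto_integral_filter_of_dominated_convergence
    (fun _ => ‖!₂[α, β]‖ ^ 2) (.of_forall fun t => ?_)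
    (.of_forall fun t => .of_forall fun k _ => norm_expectation_le _ ?_)
    intervalIntegrable_const ?_)
  · have hs := continuous_symbol (Real.pi / 4)
    exact ((continuous_expectation _).comp (by fun_prop)).aestronglyMeasurable
  · exact mul_mem (Unitary.star_mem (pow_mem (symbol_mem_unitaryGroup _ _) t))
      (pow_mem (symbol_mem_unitaryGroup _ _) t)
  · filter_upwards [Measure.ae_ne volume Real.pi] with k k_ne k_mem
    rw [Set.uIoc_of_le (by linarith [Real.pi_pos])] at k_mem
    exact ((continuous_expectation _).tendsto _).comp
      (tendsto_star_symbol_pow_mul_symbol_pow ⟨k_mem.1, k_mem.2.lt_of_ne k_ne⟩ ξ)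

/-! ### Convergence in distribution -/

theorem charFun_withDensity_ofReal {f : ℝ → ℝ} (hf : 0 ≤ f) (hfm : AEMeasurable f) (ξ : ℝ) :
    charFun (volume.withDensity fun y => ENNReal.ofReal (f y)) ξ =
      ∫ y, f y • Complex.exp (ξ * y * Complex.I) := by
  rw [charFun_apply_real, integral_withDensity_eq_integral_toReal_smul₀ hfm.ennreal_ofReal
    (.of_forall fun _ => ENNReal.ofReal_lt_top)]
  simp only [ENNReal.toReal_ofReal (hf _)]

theorem withDensity_ofReal_apply {f : ℝ → ℝ} (hf : 0 ≤ f) (hfi : Integrable f) {s : Set ℝ}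
    (hs : MeasurableSet s) :
    volume.withDensity (fun y => ENNReal.ofReal (f y)) s = ENNReal.ofReal (∫ y in s, f y) := by
  rw [withDensity_apply _ hs,
    ofReal_integral_eq_lintegral_ofReal hfi.integrableOn (.of_forall hf)]

theorem tendsto_measureReal_Iic_of_tendsto_charFun {μ : ℕ → Measure ℝ}
    [∀ t, IsProbabilityMeasure (μ t)] {f : ℝ → ℝ} (hf : 0 ≤ f) (hf_one : ∫ y, f y = 1)
    (h : ∀ ξ : ℝ, Tendsto (fun t => charFun (μ t) ξ) atTop
      (𝓝 (∫ y, f y • Complex.exp (ξ * y * Complex.I)))) (x : ℝ) :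
    Tendsto (fun t => (μ t).real (Set.Iic x)) atTop (𝓝 (∫ y in Set.Iic x, f y)) := by
  have hfi : Integrable f := integrable_of_integral_eq_one hf_one
  let ν : ProbabilityMeasure ℝ := ⟨volume.withDensity fun y => ENNReal.ofReal (f y), ⟨by
    rw [withDensity_ofReal_apply hf hfi .univ, setIntegral_univ, hf_one, ENNReal.ofReal_one]⟩⟩
  have weak : Tendsto (β := ProbabilityMeasure ℝ) (fun t => ⟨μ t, inferInstance⟩) atTop (𝓝 ν) :=
    ProbabilityMeasure.tendsto_of_tendsto_charFun fun ξ => by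
      simpa only [ν, ProbabilityMeasure.coe_mk, charFun_withDensity_ofReal hf hfi.aemeasurable]
        using h ξ
  have null_frontier : (ν : Measure ℝ) (frontier (Set.Iic x)) = 0 := by
    rw [frontier_Iic]
    exact withDensity_absolutelyContinuous _ _ Real.volume_singleton
  have limit : (ν : Measure ℝ).real (Set.Iic x) = ∫ y in Set.Iic x, f y := by
    rw [Measure.real, ProbabilityMeasure.coe_mk, withDensity_ofReal_apply hf hfi measurableSet_Iic,
      ENNReal.toReal_ofReal (integral_nonneg hf)]
  rw [← limit]
  exact (ENNReal.tendsto_toReal (measure_ne_top _ _)).comp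
    (ProbabilityMeasure.tendsto_measure_of_null_frontier_of_tendsto' weak null_frontier)

theorem tendsto_law_pi_div_four {α β : ℂ} (hαβ : ‖α‖ ^ 2 + ‖β‖ ^ 2 = 1) (x : ℝ) :
    Tendsto (fun t : ℕ => (law (Real.pi / 4) α β t).real {n : ℤ | (n : ℝ) / (t : ℝ) ≤ x}) atTop
      (𝓝 (∫ y in Set.Iic x, limitDensity α β y)) := by
  have hlaw := isProbabilityMeasure_law (Real.pi / 4) hαβ
  have rescaled (t : ℕ) :
      IsProbabilityMeasure ((law (Real.pi / 4) α β t).map fun n : ℤ => (n : ℝ) / t) :=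
    Measure.isProbabilityMeasure_map Measurable.of_discrete.aemeasurable
  refine (tendsto_measureReal_Iic_of_tendsto_charFun (limitDensity_nonneg hαβ)
    (integral_limitDensity α β) (tendsto_charFun_law hαβ) x).congr fun t => ?_
  rw [map_measureReal_apply .of_discrete measurableSet_Iic]
  rfl

end QWalk

end

theorem theorem1 (θ : ℝ) (hθ : θ = Real.pi / 4 ∨ θ = 3 * Real.pi / 4)
    (α β : ℂ) (hαβ : ‖α‖ ^ 2 + ‖β‖ ^ 2 = 1) :
    (∀ t : ℕ, IsProbabilityMeasure (QWalk.law θ α β t)) ∧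
    (∀ y ∈ Set.Ioo (-√2) √2, 0 < QWalk.limitDensity α β y) ∧
    Integrable (QWalk.limitDensity α β) ∧
    ∫ y, QWalk.limitDensity α β y = 1 ∧
    ∀ x : ℝ, Tendsto
      (fun t : ℕ => (QWalk.law θ α β t).real {n : ℤ | (n : ℝ) / (t : ℝ) ≤ x}) atTop
      (𝓝 (∫ y in Set.Iic x, QWalk.limitDensity α β y)) := by
  refine ⟨QWalk.isProbabilityMeasure_law θ hαβ, fun _ hy => QWalk.limitDensity_pos hαβ hy,
    QWalk.integrable_limitDensity α β, QWalk.integral_limitDensity α β, fun x => ?_⟩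
  have law_eq (t : ℕ) : QWalk.law θ α β t = QWalk.law (Real.pi / 4) α β t := by
    rcases hθ with rfl | rfl
    · rfl
    · rw [← QWalk.law_pi_sub]
      ring_nf
  simpa only [law_eq] using QWalk.tendsto_law_pi_div_four hαβ x
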